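/- Let $r\ge 2$, let $\pi=(1/r,\dots,1/r)$ and let $W$ be a symmetric $r\times r$ matrix with nonnegative entries. Set $M=\mathrm{diag}(\pi)W$, and let $\mu_1\ge|\mu_2|\ge\dots\ge|\mu_r|$ be the (real) eigenvalues of $M$, counted with multiplicity. Assume that all coefficients of some positive power of $M$ are positive, that $\sum_{i}M_{ij}=\alpha$ for every $j\in[r]$ (so that $\mu_1=\alpha$), that $\mu_1>1$, and that $\tau:=\mu_2^2/\mu_1>1$. For each $n$, let $G=G_n$ be a stochastic block model graph on $n$ vertices: the types $\sigma(v)$ are independent with law $\pi$ and, given the types, every two distinct vertices $u,v$ are joined by an edge, independently of the other pairs, with probability $\min(W_{\sigma(u)\sigma(v)}/n,1)$. Let $\ell=\ell(n)\sim\kappa\log_\alpha(n)$ with a constant $0<\kappa<1/12$, and let $\gamma=\gamma(n)\ge 0$ be integers with $$\gamma=o\!\left(\frac{\tau^{\ell/2}}{\log n}\right).$$ For a graph $H$ on the vertices $1,\dots,n$, let $D^{(\ell)}(H)$ be its distance matrix: the $(i,j)$ coefficient is $1$ if the graph distance between $i$ and $j$ in $H$ equals $\ell$, and $0$ otherwise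 (vertices in different components are at infinite distance). An adversary who sees $G$ may add and remove edges arbitrarily, as long as at most $\gamma$ vertices are endpoints of altered edges. Write $\tilde G$ for the resulting graph, $D^{(\ell)}=D^{(\ell)}(G)$ and $\widetilde D^{(\ell)}=D^{(\ell)}(\tilde G)$, and let $\rho$ denote the spectral radius. Then, with high probability, $\rho(\widetilde D^{(\ell)}-D^{(\ell)})=o(\mu_2^\ell)$, whatever the adversary does. That is, there is a deterministic sequence $f(n)=o(\mu_2^{\ell(n)})$ such that, with probability tending to $1$ as $n\to\infty$, every graph $\tilde G$ obtained from $G$ by altering edges with at most $\gamma(n)$ affected vertices satisfies $\rho(\widetilde D^{(\ell)}-D^{(\ell)})\le f(n)$. -/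

import Mathlib

open Filter Topology Asymptotics
open scoped ENNReal

noncomputable section

/-- Parameters of a stochastic block model with `r` blocks: a symmetric nonnegative matrix `W` and
a probability vector `prior` (usually written `π`) on the set of blocks. -/
structure BlockModel (r : ℕ) where
  W : Matrix (Fin r) (Fin r) ℝ
  symm : W.IsSymm
  nonneg : ∀ i j, 0 ≤ W i j
  prior : Fin r → ℝ
  prior_nonneg : ∀ i, 0 ≤ prior i
  prior_sum : ∑ i, prior i = 1

namespace BlockModel

variable {r : ℕ}

/-- The mean progeny matrix `M = Π W`, where `Π = diag(π)`. -/
def meanProgeny (B : BlockModel r) : Matrix (Fin r) (Fin r) ℝ :=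
  Matrix.diagonal B.prior * B.W

/-- The probability that two vertices of types `a` and `b` are adjacent in a graph with
`n` vertices. -/
def edgeProb (B : BlockModel r) (n : ℕ) (a b : Fin r) : ℝ :=
  min (B.W a b / n) 1

/-- The unordered pairs of distinct vertices, each written once, in increasing order. -/
def vertexPairs (n : ℕ) : Finset (Fin n × Fin n) :=
  Finset.univ.filter (fun e => e.1 < e.2)

open Classical in
/-- The conditional probability of the graph `G` given the types `s`: every pair of vertices is
joined independently of the others. -/
def graphWeight (B : BlockModel r) {n : ℕ} (s : Fin n → Fin r) (G : SimpleGraph (Fin n)) : ℝ :=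
  ∏ e ∈ vertexPairs n,
    if G.Adj e.1 e.2 then B.edgeProb n (s e.1) (s e.2) else 1 - B.edgeProb n (s e.1) (s e.2)

/-- The probability that the types are `x.1` (independent, with law `prior`) and that the graph
is `x.2`. -/
def weight (B : BlockModel r) {n : ℕ} (x : (Fin n → Fin r) × SimpleGraph (Fin n)) : ℝ :=
  (∏ v, B.prior (x.1 v)) * B.graphWeight x.1 x.2

theorem edgeProb_nonneg (B : BlockModel r) (n : ℕ) (a b : Fin r) : 0 ≤ B.edgeProb n a b :=
  le_min (div_nonneg (B.nonneg a b) (Nat.cast_nonneg n)) zero_le_one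

theorem edgeProb_le_one (B : BlockModel r) (n : ℕ) (a b : Fin r) : B.edgeProb n a b ≤ 1 :=
  min_le_right _ _

theorem graphWeight_nonneg (B : BlockModel r) {n : ℕ} (s : Fin n → Fin r)
    (G : SimpleGraph (Fin n)) : 0 ≤ B.graphWeight s G := by
  refine Finset.prod_nonneg fun e _ => ?_
  split_ifs
  · exact B.edgeProb_nonneg _ _ _
  · exact sub_nonneg.2 (B.edgeProb_le_one _ _ _)

theorem weight_nonneg (B : BlockModel r) {n : ℕ} (x : (Fin n → Fin r) × SimpleGraph (Fin n)) :
    0 ≤ B.weight x :=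
  mul_nonneg (Finset.prod_nonneg fun _ _ => B.prior_nonneg _) (B.graphWeight_nonneg _ _)

open Classical in
theorem graphWeight_sum (B : BlockModel r) {n : ℕ} (s : Fin n → Fin r) :
    ∑ G : SimpleGraph (Fin n), B.graphWeight s G = 1 := by
  have h1 : ∏ e ∈ vertexPairs n, (B.edgeProb n (s e.1) (s e.2)
      + (1 - B.edgeProb n (s e.1) (s e.2))) = 1 :=
    Finset.prod_eq_one fun e _ => by ring
  rw [← h1, Finset.prod_add]
  refine Finset.sum_bij'
    (fun G _ => (vertexPairs n).filter (fun e => G.Adj e.1 e.2))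
    (fun t _ => SimpleGraph.fromRel (fun u v => (u, v) ∈ t)) ?_ ?_ ?_ ?_ ?_
  · intro G _
    exact Finset.mem_powerset.2 (Finset.filter_subset _ _)
  · intro t _
    exact Finset.mem_univ _
  · intro G _
    ext u v
    simp only [SimpleGraph.fromRel_adj, vertexPairs, Finset.mem_filter, Finset.mem_univ, true_and]
    constructor
    · rintro ⟨_, h | h⟩
      · exact h.2
      · exact h.2.symm
    · intro h
      refine ⟨h.ne, ?_⟩
      rcases lt_or_gt_of_ne h.ne with h' | h'
      · exact Or.inl ⟨h', h⟩
      · exact Or.inr ⟨h', h.symm⟩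
  · intro t ht
    have ht' := Finset.mem_powerset.1 ht
    ext ⟨u, v⟩
    simp only [SimpleGraph.fromRel_adj, Finset.mem_filter]
    constructor
    · rintro ⟨huv, _, h | h⟩
      · exact h
      · have h2 := ht' h
        simp only [vertexPairs, Finset.mem_filter, Finset.mem_univ, true_and] at h2 huv
        exact absurd huv (not_lt.2 h2.le)
    · intro h
      have h2 := ht' h
      have h3 := h2
      simp only [vertexPairs, Finset.mem_filter, Finset.mem_univ, true_and] at h3
      exact ⟨h2, h3.ne, Or.inl h⟩
  · intro G _
    rw [graphWeight, Finset.prod_ite, ← Finset.filter_not]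

open Classical in
theorem weight_sum (B : BlockModel r) (n : ℕ) :
    ∑ x : (Fin n → Fin r) × SimpleGraph (Fin n), B.weight x = 1 := by
  rw [Fintype.sum_prod_type]
  simp only [weight, ← Finset.mul_sum, graphWeight_sum, mul_one]
  have h := Finset.prod_univ_sum (fun _ : Fin n => (Finset.univ : Finset (Fin r)))
    (fun _ i => B.prior i)
  simp only [B.prior_sum, Finset.prod_const_one, Fintype.piFinset_univ] at h
  convert h.symm

open Classical in
/-- The joint law of the types and of the graph in the stochastic block model on `n` vertices. -/
def law (B : BlockModel r) (n : ℕ) : PMF ((Fin n → Fin r) × SimpleGraph (Fin n)) :=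
  PMF.ofFintype (fun x => ENNReal.ofReal (B.weight x)) (by
    rw [← ENNReal.ofReal_sum_of_nonneg fun x _ => B.weight_nonneg x, B.weight_sum n,
      ENNReal.ofReal_one])

end BlockModel

/-- The family `μ` lists the eigenvalues of `M`, with multiplicities, by nonincreasing
absolute value. -/
def ListsEigenvalues {r : ℕ} (M : Matrix (Fin r) (Fin r) ℝ) (μ : Fin r → ℝ) : Prop :=
  M.charpoly = ∏ i, (Polynomial.X - Polynomial.C (μ i)) ∧ ∀ i j, i ≤ j → |μ j| ≤ |μ i|

open Classical in
/-- The distance matrix: its `(i, j)` coefficient is `1` if `d(i, j) = ℓ` and `0` otherwise, where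
`d` is the graph distance, infinite between different connected components. -/
def distanceMatrix {n : ℕ} (G : SimpleGraph (Fin n)) (l : ℕ) : Matrix (Fin n) (Fin n) ℝ :=
  Matrix.of fun i j => if G.edist i j = (l : ℕ∞) then 1 else 0

/-- The vertices affected when `G` is changed into `G'`: the endpoints of altered (added or
removed) edges. -/
def affectedVertices {n : ℕ} (G G' : SimpleGraph (Fin n)) : Set (Fin n) :=
  {v | ∃ w, ¬ (G.Adj v w ↔ G'.Adj v w)}

/-- The spectral radius of a real square matrix: the largest modulus of a complex eigenvalue. -/
def matrixSpectralRadius {n : ℕ} (A : Matrix (Fin n) (Fin n) ℝ) : ℝ≥0∞ :=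
  spectralRadius ℂ (A.map (algebraMap ℝ ℂ))

end

/-! Let `K` be the set of affected vertices. If the `(i, j)` coefficient changes, a shortest path in
`G` or in the altered graph uses an altered edge. Its initial and final unaltered segments give
`d(i, K) + d(j, K) ≤ ℓ`, with distances in `G` (`setEdist_add_le_of_distanceMatrix_ne`).

With high probability every sphere of radius `t ≤ ℓ` in `G` has size `O(log n) μ₁ ^ t`
(`tendsto_law_spheresBounded`), so at most `γ O(log n) μ₁ ^ t` vertices are at distance `t` from
`K`. With weights `μ₁ ^ (-d(i, K) / 2)`, the weighted row sums are geometric and bound the spectral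
radius by `O(γ log n) μ₁ ^ (ℓ / 2)` (`matrixSpectralRadius_le_of_growth`). As `τ μ₁ = μ₂ ^ 2`, the
hypothesis on `γ` makes this `o(|μ₂| ^ ℓ)`.

The sphere bound follows from exponential moments of breadth first layers
(`graphMean_exp_card_bfsLayer_le`): given the previous layers, a layer is dominated by a sum of
independent Bernoulli variables. Concentration of the types keeps the expected degrees at most `μ₁ +
n ^ (-1/4)`, and the excess is harmless over logarithmically many generations. -/

/-! ### Product structure of the law of the graph given the types. -/

section GraphMoments

-- Graphs correspond to subsets of the set of increasing pairs, so the sum is the expansion of the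
-- product. It makes expectations of products over pairs factor.
open Classical in
theorem sum_simpleGraph_prod_ite {n : ℕ} (a b : Fin n × Fin n → ℝ) :
    ∑ G : SimpleGraph (Fin n), ∏ e ∈ BlockModel.vertexPairs n,
      (if G.Adj e.1 e.2 then a e else b e) = ∏ e ∈ BlockModel.vertexPairs n, (a e + b e) := by
  rw [Finset.prod_add]
  refine Finset.sum_bij'
    (fun G _ => (BlockModel.vertexPairs n).filter (fun e => G.Adj e.1 e.2))
    (fun t _ => SimpleGraph.fromRel (fun u v => (u, v) ∈ t)) ?_ ?_ ?_ ?_ ?_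
  · intro G _
    exact Finset.mem_powerset.2 (Finset.filter_subset _ _)
  · intro t _
    exact Finset.mem_univ _
  · intro G _
    ext u v
    simp only [SimpleGraph.fromRel_adj, BlockModel.vertexPairs, Finset.mem_filter,
      Finset.mem_univ, true_and]
    constructor
    · rintro ⟨_, h | h⟩
      · exact h.2
      · exact h.2.symm
    · intro h
      refine ⟨h.ne, ?_⟩
      rcases lt_or_gt_of_ne h.ne with h' | h'
      · exact Or.inl ⟨h', h⟩
      · exact Or.inr ⟨h', h.symm⟩
  · intro t ht
    have ht' := Finset.mem_powerset.1 ht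
    ext ⟨u, v⟩
    simp only [SimpleGraph.fromRel_adj, Finset.mem_filter]
    constructor
    · rintro ⟨huv, _, h | h⟩
      · exact h
      · have h2 := ht' h
        simp only [BlockModel.vertexPairs, Finset.mem_filter, Finset.mem_univ, true_and] at h2 huv
        exact absurd huv (not_lt.2 h2.le)
    · intro h
      have h2 := ht' h
      have h3 := h2
      simp only [BlockModel.vertexPairs, Finset.mem_filter, Finset.mem_univ, true_and] at h3
      exact ⟨h2, h3.ne, Or.inl h⟩
  · intro G _
    rw [Finset.prod_ite, ← Finset.filter_not]

/-- The graph with the edges of `G` that touch `A` and the edges of `H` that do not. -/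
def mixGraph {V : Type*} (A : Finset V) (G H : SimpleGraph V) : SimpleGraph V where
  Adj u v := ((u ∈ A ∨ v ∈ A) ∧ G.Adj u v) ∨ (¬ (u ∈ A ∨ v ∈ A) ∧ H.Adj u v)
  symm := ⟨fun u v h => by
    rw [or_comm (a := v ∈ A), G.adj_comm v u, H.adj_comm v u]; exact h⟩
  loopless := ⟨fun u h => by simp at h⟩

theorem mixGraph_adj_of_touch {V : Type*} {A : Finset V} (G H : SimpleGraph V) {u v : V}
    (h : u ∈ A ∨ v ∈ A) : (mixGraph A G H).Adj u v ↔ G.Adj u v := by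
  simp only [mixGraph, h, true_and, not_true_eq_false, false_and, or_false]

theorem mixGraph_adj_of_not_touch {V : Type*} {A : Finset V} (G H : SimpleGraph V) {u v : V}
    (h : ¬ (u ∈ A ∨ v ∈ A)) : (mixGraph A G H).Adj u v ↔ H.Adj u v := by
  simp only [mixGraph, h, false_and, not_false_eq_true, true_and, false_or]

theorem mixGraph_mixGraph {V : Type*} (A : Finset V) (G H : SimpleGraph V) :
    mixGraph A (mixGraph A G H) (mixGraph A H G) = G := by
  ext u v
  by_cases h : u ∈ A ∨ v ∈ A
  · rw [mixGraph_adj_of_touch _ _ h, mixGraph_adj_of_touch _ _ h]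
  · rw [mixGraph_adj_of_not_touch _ _ h, mixGraph_adj_of_not_touch _ _ h]

variable {r : ℕ}

open Classical in
/-- The conditional expectation of a function of the graph given the types `s`. -/
noncomputable def graphMean (B : BlockModel r) {n : ℕ} (s : Fin n → Fin r)
    (f : SimpleGraph (Fin n) → ℝ) : ℝ :=
  ∑ G : SimpleGraph (Fin n), B.graphWeight s G * f G

theorem graphMean_mono (B : BlockModel r) {n : ℕ} (s : Fin n → Fin r)
    {f g : SimpleGraph (Fin n) → ℝ} (h : ∀ G, f G ≤ g G) : graphMean B s f ≤ graphMean B s g :=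
  Finset.sum_le_sum fun G _ => mul_le_mul_of_nonneg_left (h G) (B.graphWeight_nonneg s G)

theorem graphMean_nonneg (B : BlockModel r) {n : ℕ} (s : Fin n → Fin r)
    {f : SimpleGraph (Fin n) → ℝ} (h : ∀ G, 0 ≤ f G) : 0 ≤ graphMean B s f :=
  Finset.sum_nonneg fun G _ => mul_nonneg (B.graphWeight_nonneg s G) (h G)

theorem graphMean_sum (B : BlockModel r) {n : ℕ} (s : Fin n → Fin r) {ι : Type*} (T : Finset ι)
    (f : ι → SimpleGraph (Fin n) → ℝ) :
    graphMean B s (fun G => ∑ i ∈ T, f i G) = ∑ i ∈ T, graphMean B s (f i) := by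
  simp only [graphMean, Finset.mul_sum]
  exact Finset.sum_comm

theorem graphMean_mul_const (B : BlockModel r) {n : ℕ} (s : Fin n → Fin r)
    (f : SimpleGraph (Fin n) → ℝ) (c : ℝ) :
    graphMean B s (fun G => f G * c) = graphMean B s f * c := by
  simp only [graphMean, Finset.sum_mul, mul_assoc]

/-- At each pair the two factors are either kept or exchanged. -/
theorem graphWeight_mixGraph (B : BlockModel r) {n : ℕ} (s : Fin n → Fin r) (A : Finset (Fin n))
    (G H : SimpleGraph (Fin n)) :
    B.graphWeight s (mixGraph A G H) * B.graphWeight s (mixGraph A H G)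
      = B.graphWeight s G * B.graphWeight s H := by
  classical
  simp only [BlockModel.graphWeight, ← Finset.prod_mul_distrib]
  refine Finset.prod_congr rfl fun e _ => ?_
  by_cases h : e.1 ∈ A ∨ e.2 ∈ A
  · exact congrArg₂ (· * ·) (if_congr (mixGraph_adj_of_touch G H h) rfl rfl)
      (if_congr (mixGraph_adj_of_touch H G h) rfl rfl)
  · exact (congrArg₂ (· * ·) (if_congr (mixGraph_adj_of_not_touch G H h) rfl rfl)
      (if_congr (mixGraph_adj_of_not_touch H G h) rfl rfl)).trans (mul_comm _ _)

/-- Functions of the edges touching `A` are independent of functions of the other edges. -/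
theorem graphMean_mul (B : BlockModel r) {n : ℕ} (s : Fin n → Fin r) (A : Finset (Fin n))
    {f g : SimpleGraph (Fin n) → ℝ} (hf : ∀ G H, f (mixGraph A G H) = f G)
    (hg : ∀ G H, g (mixGraph A G H) = g H) :
    graphMean B s (fun G => f G * g G) = graphMean B s f * graphMean B s g := by
  classical
  -- A second independent copy `H` is introduced. Exchanging the edges of `G` and `H` that do not
  -- touch `A` is a weight-preserving involution, and it turns `f G * g G` into `f G * g H`.
  have h1 : graphMean B s (fun G => f G * g G)
      = ∑ x : SimpleGraph (Fin n) × SimpleGraph (Fin n),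
        B.graphWeight s x.1 * B.graphWeight s x.2 * (f x.1 * g x.1) := by
    rw [Fintype.sum_prod_type]
    refine Finset.sum_congr rfl fun G _ => ?_
    dsimp only
    rw [← Finset.sum_mul, ← Finset.mul_sum, B.graphWeight_sum, mul_one]
  have h2 : graphMean B s f * graphMean B s g
      = ∑ x : SimpleGraph (Fin n) × SimpleGraph (Fin n),
        B.graphWeight s x.1 * B.graphWeight s x.2 * (f x.1 * g x.2) := by
    rw [Fintype.sum_prod_type, graphMean, graphMean, Finset.sum_mul_sum]
    refine Finset.sum_congr rfl fun G _ => Finset.sum_congr rfl fun H _ => ?_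
    ring
  rw [h1, h2]
  refine Finset.sum_bij' (fun x _ => (mixGraph A x.1 x.2, mixGraph A x.2 x.1))
    (fun x _ => (mixGraph A x.1 x.2, mixGraph A x.2 x.1))
    (fun _ _ => Finset.mem_univ _) (fun _ _ => Finset.mem_univ _) ?_ ?_ ?_
  · intro x _
    simp only [mixGraph_mixGraph]
  · intro x _
    simp only [mixGraph_mixGraph]
  · intro x _
    simp only [graphWeight_mixGraph, hf]
    rw [hg x.2 x.1]

/-! ### Breadth first exploration and its exponential moments. -/

open Classical in
/-- The vertices of `U` adjacent to a vertex of `A`. -/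
noncomputable def neighborsIn {V : Type*} (G : SimpleGraph V) (A U : Finset V) : Finset V :=
  U.filter fun u => ∃ a ∈ A, G.Adj a u

/-- The last set met in a breadth first exploration of depth `t` that starts with the set `A`
and may discover the vertices of `U`. -/
noncomputable def bfsLayer {V : Type*} [DecidableEq V] (G : SimpleGraph V) : ℕ → Finset V → Finset V → Finset V
  | 0, A, _ => A
  | t + 1, A, U => bfsLayer G t (neighborsIn G A U) (U \ neighborsIn G A U)

theorem mem_neighborsIn {V : Type*} {G : SimpleGraph V} {A U : Finset V} {u : V} :
    u ∈ neighborsIn G A U ↔ u ∈ U ∧ ∃ a ∈ A, G.Adj a u := by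
  classical
  simp only [neighborsIn, Finset.mem_filter]

theorem neighborsIn_subset {V : Type*} (G : SimpleGraph V) (A U : Finset V) :
    neighborsIn G A U ⊆ U :=
  fun _ hu => (mem_neighborsIn.1 hu).1

theorem neighborsIn_mixGraph {V : Type*} (G H : SimpleGraph V) (A U : Finset V) :
    neighborsIn (mixGraph A G H) A U = neighborsIn G A U := by
  ext u
  simp only [mem_neighborsIn]
  refine and_congr_right fun _ => exists_congr fun a => and_congr_right fun ha => ?_
  exact mixGraph_adj_of_touch G H (Or.inl ha)

theorem neighborsIn_mixGraph_of_disjoint {V : Type*} (G H : SimpleGraph V) {A A' U : Finset V}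
    (hA : Disjoint A' A) (hU : Disjoint U A) :
    neighborsIn (mixGraph A G H) A' U = neighborsIn H A' U := by
  ext u
  simp only [mem_neighborsIn]
  refine and_congr_right fun hu => exists_congr fun a => and_congr_right fun ha => ?_
  refine mixGraph_adj_of_not_touch G H ?_
  rintro (h | h)
  · exact Finset.disjoint_left.1 hA ha h
  · exact Finset.disjoint_left.1 hU hu h

theorem bfsLayer_mixGraph_of_disjoint {V : Type*} [DecidableEq V] (G H : SimpleGraph V) {A : Finset V} (t : ℕ)
    {A' U : Finset V} (hA : Disjoint A' A) (hU : Disjoint U A) :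
    bfsLayer (mixGraph A G H) t A' U = bfsLayer H t A' U := by
  induction t generalizing A' U with
  | zero => rfl
  | succ t ih =>
    simp only [bfsLayer]
    rw [neighborsIn_mixGraph_of_disjoint G H hA hU]
    exact ih (hU.mono_left (neighborsIn_subset H A' U)) (hU.mono_left Finset.sdiff_subset)

theorem edgeProb_comm (B : BlockModel r) (n : ℕ) (a b : Fin r) :
    B.edgeProb n a b = B.edgeProb n b a := by
  simp only [BlockModel.edgeProb, B.symm.apply a b]

theorem sum_vertexPairs_le {n : ℕ} (F : Fin n → Fin n → ℝ) (hF : ∀ a b, 0 ≤ F a b) :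
    ∑ e ∈ BlockModel.vertexPairs n, (F e.1 e.2 + F e.2 e.1) ≤ ∑ a, ∑ b, F a b := by
  classical
  have h1 : ∑ e ∈ BlockModel.vertexPairs n, F e.2 e.1
      = ∑ e ∈ Finset.univ.filter (fun e : Fin n × Fin n => e.2 < e.1), F e.1 e.2 := by
    refine Finset.sum_bij' (fun e _ => e.swap) (fun e _ => e.swap) ?_ ?_ ?_ ?_ ?_ <;>
      simp [BlockModel.vertexPairs]
  rw [Finset.sum_add_distrib, h1, ← Fintype.sum_prod_type', ← Finset.sum_union]
  · exact Finset.sum_le_sum_of_subset_of_nonneg (Finset.subset_univ _) fun e _ _ => hF _ _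
  · rw [Finset.disjoint_left]
    intro e h h'
    simp only [BlockModel.vertexPairs, Finset.mem_filter, Finset.mem_univ, true_and] at h h'
    exact lt_asymm h h'

open Classical in
/-- The pairs with one element in `A` and the other one in `U`. -/
noncomputable def crossingPairs {n : ℕ} (A U : Finset (Fin n)) : Finset (Fin n × Fin n) :=
  (BlockModel.vertexPairs n).filter fun e => (e.1 ∈ A ∧ e.2 ∈ U) ∨ (e.2 ∈ A ∧ e.1 ∈ U)

theorem sum_edgeProb_crossingPairs_le (B : BlockModel r) {n : ℕ} (s : Fin n → Fin r) {β : ℝ}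
    (hs : ∀ j, ∑ u, B.edgeProb n (s u) j ≤ β) (A U : Finset (Fin n)) :
    ∑ e ∈ crossingPairs A U, B.edgeProb n (s e.1) (s e.2) ≤ A.card * β := by
  classical
  -- Each crossing pair is charged to its endpoint in `A`, whose expected degree is at most `β`.
  let F : Fin n → Fin n → ℝ := fun a b => if a ∈ A then B.edgeProb n (s b) (s a) else 0
  have hF : ∀ a b, 0 ≤ F a b := fun a b => by
    dsimp only [F]; split_ifs
    · exact B.edgeProb_nonneg _ _ _
    · exact le_rfl
  calc ∑ e ∈ crossingPairs A U, B.edgeProb n (s e.1) (s e.2)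
      ≤ ∑ e ∈ crossingPairs A U, (F e.1 e.2 + F e.2 e.1) := by
        refine Finset.sum_le_sum fun e he => ?_
        rcases (Finset.mem_filter.1 he).2 with h | h
        · have h0 := hF e.2 e.1
          have : F e.1 e.2 = B.edgeProb n (s e.1) (s e.2) := by
            simp only [F, h.1, if_true]; exact edgeProb_comm B n _ _
          linarith
        · have h0 := hF e.1 e.2
          have : F e.2 e.1 = B.edgeProb n (s e.1) (s e.2) := by
            simp only [F, h.1, if_true]
          linarith
    _ ≤ ∑ e ∈ BlockModel.vertexPairs n, (F e.1 e.2 + F e.2 e.1) :=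
        Finset.sum_le_sum_of_subset_of_nonneg (Finset.filter_subset _ _)
          fun e _ _ => add_nonneg (hF _ _) (hF _ _)
    _ ≤ ∑ a, ∑ b, F a b := sum_vertexPairs_le F hF
    _ ≤ ∑ a, if a ∈ A then β else 0 := by
        refine Finset.sum_le_sum fun a _ => ?_
        by_cases ha : a ∈ A
        · simp only [F, ha, if_true]; exact hs _
        · simp only [F, ha, if_false, Finset.sum_const_zero, le_refl]
    _ = A.card * β := by simp

-- Every discovered vertex is the endpoint outside `A` of at least one crossing edge that is
-- present.
open Classical in
theorem card_neighborsIn_le {n : ℕ} (G : SimpleGraph (Fin n)) {A U : Finset (Fin n)}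
    (hAU : Disjoint A U) :
    (neighborsIn G A U).card ≤ ((crossingPairs A U).filter fun e => G.Adj e.1 e.2).card := by
  refine (Finset.card_le_card (t := ((crossingPairs A U).filter fun e => G.Adj e.1 e.2).image
    fun e => if e.1 ∈ A then e.2 else e.1) ?_).trans Finset.card_image_le
  intro u hu
  obtain ⟨huU, a, ha, hadj⟩ := mem_neighborsIn.1 hu
  have huA : u ∉ A := fun h => Finset.disjoint_left.1 hAU h huU
  simp only [Finset.mem_image, Finset.mem_filter, crossingPairs, BlockModel.vertexPairs,
    Finset.mem_univ, true_and]
  rcases lt_or_gt_of_ne hadj.ne with h | h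
  · exact ⟨(a, u), ⟨⟨h, Or.inl ⟨ha, huU⟩⟩, hadj⟩, by simp [ha]⟩
  · exact ⟨(u, a), ⟨⟨h, Or.inr ⟨ha, huU⟩⟩, hadj.symm⟩, by simp [huA]⟩

-- The present crossing edges are independent Bernoulli variables with total mean at most `β *
-- A.card`; each factor is bounded with `1 + x ≤ exp x`.
open Classical in
theorem graphMean_exp_card_neighborsIn_le (B : BlockModel r) {n : ℕ} (s : Fin n → Fin r) {β : ℝ}
    (hs : ∀ j, ∑ u, B.edgeProb n (s u) j ≤ β) {A U : Finset (Fin n)} (hAU : Disjoint A U)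
    {θ : ℝ} (hθ : 0 ≤ θ) :
    graphMean B s (fun G => Real.exp (θ * (neighborsIn G A U).card))
      ≤ Real.exp (β * (Real.exp θ - 1) * A.card) := by
  let c : Fin n × Fin n → ℝ := fun e => if e ∈ crossingPairs A U then Real.exp θ else 1
  let p : Fin n × Fin n → ℝ := fun e => B.edgeProb n (s e.1) (s e.2)
  have h1 : ∀ G : SimpleGraph (Fin n), Real.exp (θ * (neighborsIn G A U).card)
      ≤ ∏ e ∈ BlockModel.vertexPairs n, if G.Adj e.1 e.2 then c e else 1 := by
    intro G
    have : ∏ e ∈ BlockModel.vertexPairs n, (if G.Adj e.1 e.2 then c e else 1)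
        = Real.exp θ ^ ((crossingPairs A U).filter fun e => G.Adj e.1 e.2).card := by
      rw [← Finset.prod_const, ← Finset.prod_filter]
      simp only [c, ← Finset.prod_filter]
      refine Finset.prod_congr ?_ fun _ _ => rfl
      ext e
      simp only [crossingPairs, Finset.mem_filter]
      tauto
    rw [this, ← Real.exp_nat_mul, mul_comm]
    gcongr
    exact card_neighborsIn_le G hAU
  calc graphMean B s (fun G => Real.exp (θ * (neighborsIn G A U).card))
      ≤ graphMean B s (fun G => ∏ e ∈ BlockModel.vertexPairs n,
          if G.Adj e.1 e.2 then c e else 1) := graphMean_mono B s h1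
    _ = ∑ G : SimpleGraph (Fin n), ∏ e ∈ BlockModel.vertexPairs n,
          (if G.Adj e.1 e.2 then p e * c e else 1 - p e) := by
        refine Finset.sum_congr rfl fun G _ => ?_
        rw [BlockModel.graphWeight, ← Finset.prod_mul_distrib]
        refine Finset.prod_congr rfl fun e _ => ?_
        split_ifs <;> simp [p]
    _ = ∏ e ∈ BlockModel.vertexPairs n, (p e * c e + (1 - p e)) :=
        sum_simpleGraph_prod_ite (fun e => p e * c e) (fun e => 1 - p e)
    _ ≤ ∏ e ∈ BlockModel.vertexPairs n, Real.exp (p e * (c e - 1)) := by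
        have hc : ∀ e, 1 ≤ c e := fun e => by
          dsimp only [c]; split_ifs
          · exact Real.one_le_exp hθ
          · exact le_rfl
        refine Finset.prod_le_prod (fun e _ => ?_) fun e _ => ?_
        · have h0 : 0 ≤ p e := B.edgeProb_nonneg _ _ _
          nlinarith [hc e]
        · have := Real.add_one_le_exp (p e * (c e - 1))
          linarith
    _ = Real.exp ((Real.exp θ - 1) * ∑ e ∈ crossingPairs A U, p e) := by
        rw [← Real.exp_sum, Finset.mul_sum, crossingPairs, Finset.sum_filter]
        congr 1
        refine Finset.sum_congr rfl fun e he => ?_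
        simp only [c, crossingPairs, Finset.mem_filter, he, true_and]
        split_ifs <;> ring
    _ ≤ Real.exp (β * (Real.exp θ - 1) * A.card) := by
        have h2 := sum_edgeProb_crossingPairs_le B s hs A U
        have h3 : 0 ≤ Real.exp θ - 1 := sub_nonneg.2 (Real.one_le_exp hθ)
        refine Real.exp_le_exp.2 ?_
        calc (Real.exp θ - 1) * ∑ e ∈ crossingPairs A U, p e
            ≤ (Real.exp θ - 1) * (A.card * β) := mul_le_mul_of_nonneg_left h2 h3
          _ = _ := by ring

/-- One generation turns an exponent `y` into `β * (exp y - 1)`. For `y = x + k * x ^ 2` the error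
`y ^ 2 ≤ 4 * x ^ 2` is absorbed by `k * (β - 1) * x ^ 2`, so the form of `y` is preserved with `x`
replaced by `β * x`, and no constant accumulates over the generations. -/
theorem mul_exp_sub_one_le {k β x : ℝ} (hk : 0 ≤ k) (hβ : 4 ≤ k * (β - 1)) (hx : 0 ≤ x)
    (hxk : k * x ≤ 1) (hx' : x ≤ 1 / 2) (hβ0 : 1 ≤ β) :
    β * (Real.exp (x + k * x ^ 2) - 1) ≤ β * x + k * (β * x) ^ 2 := by
  set y := x + k * x ^ 2 with hy
  have hy0 : 0 ≤ y := by positivity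
  have hy2 : y ≤ 2 * x := by nlinarith
  have hexp : Real.exp y - 1 ≤ y + y ^ 2 := by
    have h := Real.abs_exp_sub_one_sub_id_le (x := y) (by rw [abs_of_nonneg hy0]; linarith)
    have := (abs_le.1 h).2
    linarith
  have h4 : y ^ 2 ≤ 4 * x ^ 2 := by nlinarith
  have h5 : Real.exp y - 1 ≤ x + k * β * x ^ 2 := by
    have : 4 * x ^ 2 ≤ k * (β - 1) * x ^ 2 := mul_le_mul_of_nonneg_right hβ (sq_nonneg x)
    calc Real.exp y - 1 ≤ y + y ^ 2 := hexp
      _ ≤ x + k * x ^ 2 + k * (β - 1) * x ^ 2 := by linarith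
      _ = _ := by ring
  calc β * (Real.exp y - 1) ≤ β * (x + k * β * x ^ 2) :=
        mul_le_mul_of_nonneg_left h5 (by linarith)
    _ = _ := by ring

/-- Exponential moments of the layers of a breadth first exploration. -/
theorem graphMean_exp_card_bfsLayer_le (B : BlockModel r) {n : ℕ} (s : Fin n → Fin r) {β : ℝ}
    (hs : ∀ j, ∑ u, B.edgeProb n (s u) j ≤ β) {k : ℝ} (hk : 0 ≤ k) (hβ : 4 ≤ k * (β - 1))
    (hβ0 : 1 ≤ β) {x : ℝ} (hx : 0 ≤ x) (t : ℕ) (hxk : k * (x * β ^ t) ≤ 1)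
    (hx' : x * β ^ t ≤ 1 / 2) {A U : Finset (Fin n)} (hAU : Disjoint A U) :
    graphMean B s (fun G => Real.exp ((x + k * x ^ 2) * (bfsLayer G t A U).card))
      ≤ Real.exp ((x * β ^ t + k * (x * β ^ t) ^ 2) * A.card) := by
  classical
  induction t generalizing A U with
  | zero =>
    simp only [bfsLayer, pow_zero, mul_one]
    rw [graphMean, ← Finset.sum_mul, B.graphWeight_sum, one_mul]
  | succ t ih =>
    have hle : x * β ^ t ≤ x * β ^ (t + 1) := by
      gcongr
      exact t.le_succ
    have hxk' : k * (x * β ^ t) ≤ 1 := (mul_le_mul_of_nonneg_left hle hk).trans hxk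
    have hx2 : x * β ^ t ≤ 1 / 2 := hle.trans hx'
    have h0 : 0 ≤ x * β ^ t := by positivity
    set z := x * β ^ t with hz
    -- Decomposition according to the value `S` of the first layer.
    have hsplit : ∀ (φ : Finset (Fin n) → SimpleGraph (Fin n) → ℝ) (G : SimpleGraph (Fin n)),
        φ (neighborsIn G A U) G
          = ∑ S ∈ U.powerset, (if neighborsIn G A U = S then 1 else 0) * φ S G := by
      intro φ G
      simp only [ite_mul, one_mul, zero_mul]
      rw [Finset.sum_ite_eq, if_pos (Finset.mem_powerset.2 (neighborsIn_subset G A U))]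
    calc graphMean B s (fun G => Real.exp ((x + k * x ^ 2) * (bfsLayer G (t + 1) A U).card))
        = ∑ S ∈ U.powerset, graphMean B s (fun G => (if neighborsIn G A U = S then 1 else 0)
            * Real.exp ((x + k * x ^ 2) * (bfsLayer G t S (U \ S)).card)) := by
          rw [← graphMean_sum]
          congr 1
          funext G
          exact hsplit (fun S G => Real.exp ((x + k * x ^ 2) * (bfsLayer G t S (U \ S)).card)) G
      _ ≤ ∑ S ∈ U.powerset, graphMean B s (fun G => (if neighborsIn G A U = S then 1 else 0)
            * Real.exp ((z + k * z ^ 2) * S.card)) := by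
          refine Finset.sum_le_sum fun S hS => ?_
          have hSU := Finset.mem_powerset.1 hS
          -- The first layer depends only on the edges touching `A`; the exploration continued from
          -- `S` inside `U \ S` sees only the others.
          rw [graphMean_mul B s A, graphMean_mul_const]
          · refine mul_le_mul_of_nonneg_left (ih hxk' hx2 Finset.disjoint_sdiff)
              (graphMean_nonneg B s fun G => ?_)
            split_ifs <;> norm_num
          · intro G H
            rw [neighborsIn_mixGraph]
          · intro G H
            rw [bfsLayer_mixGraph_of_disjoint G H t (hAU.symm.mono_left hSU)
              (hAU.symm.mono_left Finset.sdiff_subset)]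
      _ = graphMean B s (fun G => Real.exp ((z + k * z ^ 2) * (neighborsIn G A U).card)) := by
          rw [← graphMean_sum]
          congr 1
          funext G
          exact (hsplit (fun S _ => Real.exp ((z + k * z ^ 2) * S.card)) G).symm
      _ ≤ Real.exp (β * (Real.exp (z + k * z ^ 2) - 1) * A.card) :=
          graphMean_exp_card_neighborsIn_le B s hs hAU (by positivity)
      _ ≤ Real.exp ((x * β ^ (t + 1) + k * (x * β ^ (t + 1)) ^ 2) * A.card) := by
          have h := mul_exp_sub_one_le hk hβ h0 hxk' hx2 hβ0
          have e : β * z = x * β ^ (t + 1) := by rw [hz]; ring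
          rw [e] at h
          gcongr

end GraphMoments

/-! ### Deterministic effect of altered edges on the distance matrix. -/

section Perturbation

open Classical in
/-- The vertices at distance `t` from `v`. -/
noncomputable def sphere {n : ℕ} (G : SimpleGraph (Fin n)) (v : Fin n) (t : ℕ) : Finset (Fin n) :=
  Finset.univ.filter fun w => G.edist v w = t

open Classical in
/-- The vertices at distance more than `t` from `v`. -/
noncomputable def outsideBall {n : ℕ} (G : SimpleGraph (Fin n)) (v : Fin n) (t : ℕ) :
    Finset (Fin n) :=
  Finset.univ.filter fun w => (t : ℕ∞) < G.edist v w

theorem mem_sphere {n : ℕ} {G : SimpleGraph (Fin n)} {v w : Fin n} {t : ℕ} :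
    w ∈ sphere G v t ↔ G.edist v w = t := by
  classical
  simp only [sphere, Finset.mem_filter, Finset.mem_univ, true_and]

theorem mem_outsideBall {n : ℕ} {G : SimpleGraph (Fin n)} {v w : Fin n} {t : ℕ} :
    w ∈ outsideBall G v t ↔ (t : ℕ∞) < G.edist v w := by
  classical
  simp only [outsideBall, Finset.mem_filter, Finset.mem_univ, true_and]

theorem exists_walk_length_of_edist_eq {V : Type*} {G : SimpleGraph V} {u v : V} {t : ℕ}
    (h : G.edist u v = t) : ∃ p : G.Walk u v, p.length = t := by
  have hr : G.Reachable u v :=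
    SimpleGraph.reachable_of_edist_ne_top (by rw [h]; exact ENat.natCast_ne_top t)
  obtain ⟨p, hp⟩ := hr.exists_walk_length_eq_edist
  exact ⟨p, by rw [h] at hp; exact_mod_cast hp⟩

theorem neighborsIn_sphere {n : ℕ} (G : SimpleGraph (Fin n)) (v : Fin n) (t : ℕ) :
    neighborsIn G (sphere G v t) (outsideBall G v t) = sphere G v (t + 1) := by
  ext u
  rw [mem_neighborsIn, mem_outsideBall, mem_sphere]
  constructor
  · rintro ⟨hu, a, ha, hadj⟩
    rw [mem_sphere] at ha
    refine le_antisymm ?_ ?_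
    · refine (G.edist_triangle (v := a)).trans ?_
      rw [ha, SimpleGraph.edist_eq_one_iff_adj.2 hadj]
      exact_mod_cast le_rfl
    · exact_mod_cast Order.add_one_le_of_lt hu
  · intro h
    refine ⟨by rw [h]; exact_mod_cast t.lt_succ_self, ?_⟩
    obtain ⟨p, hp⟩ := exists_walk_length_of_edist_eq ((G.edist_comm (u := u) (v := v)).trans h)
    cases p with
    | nil => simp at hp
    | @cons _ a _ hadj q =>
      have hq : q.length = t := by simpa using hp
      refine ⟨a, mem_sphere.2 ?_, hadj.symm⟩
      have h1 : G.edist v a ≤ t := by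
        rw [G.edist_comm, ← hq]; exact SimpleGraph.edist_le q
      have h2 : ((t + 1 : ℕ) : ℕ∞) ≤ G.edist v a + 1 := by
        rw [← h, ← SimpleGraph.edist_eq_one_iff_adj.2 hadj.symm]
        exact G.edist_triangle
      refine le_antisymm h1 ?_
      push_cast at h2
      exact (ENat.add_le_add_iff_right ENat.one_ne_top).1 h2

theorem outsideBall_sdiff_sphere {n : ℕ} (G : SimpleGraph (Fin n)) (v : Fin n) (t : ℕ) :
    outsideBall G v t \ sphere G v (t + 1) = outsideBall G v (t + 1) := by
  ext u
  rw [Finset.mem_sdiff, mem_outsideBall, mem_sphere, mem_outsideBall]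
  constructor
  · rintro ⟨h1, h2⟩
    refine lt_of_le_of_ne ?_ (Ne.symm h2)
    exact_mod_cast Order.add_one_le_of_lt h1
  · intro h
    refine ⟨lt_trans ?_ h, h.ne'⟩
    exact_mod_cast t.lt_succ_self

/-- The starting radius `s` is arbitrary because the recursion of `bfsLayer` advances the starting
set. -/
theorem bfsLayer_sphere {n : ℕ} (G : SimpleGraph (Fin n)) (v : Fin n) (s t : ℕ) :
    bfsLayer G t (sphere G v s) (outsideBall G v s) = sphere G v (s + t) := by
  induction t generalizing s with
  | zero => rfl
  | succ t ih =>
    rw [bfsLayer, neighborsIn_sphere, outsideBall_sdiff_sphere, ih, add_assoc, add_comm 1 t]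

theorem sphere_eq_bfsLayer {n : ℕ} (G : SimpleGraph (Fin n)) (v : Fin n) (t : ℕ) :
    sphere G v t = bfsLayer G t {v} (Finset.univ \ {v}) := by
  have h1 : sphere G v 0 = {v} := by
    ext u
    rw [mem_sphere, Finset.mem_singleton, Nat.cast_zero, SimpleGraph.edist_eq_zero_iff, eq_comm]
  have h2 : outsideBall G v 0 = Finset.univ \ {v} := by
    ext u
    rw [mem_outsideBall, Nat.cast_zero, pos_iff_ne_zero, Ne, SimpleGraph.edist_eq_zero_iff,
      eq_comm]
    simp
  rw [← h2, ← h1, bfsLayer_sphere, zero_add]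

/-- Either no altered edge is used, and the walk lives in `Q` and `G`; or `k` is the start of the
first altered edge and `k'` the end of the last one, and the segments before and after them are
walks in `G`. -/
theorem walk_transfer_or_exists {V : Type*} {G P Q : SimpleGraph V} {K : Set V}
    (h : ∀ a b, P.Adj a b → (Q.Adj a b ∧ G.Adj a b) ∨ (a ∈ K ∧ b ∈ K)) {i j : V}
    (p : P.Walk i j) :
    ((∃ q : Q.Walk i j, q.length = p.length) ∧ G.edist i j ≤ p.length) ∨
      ∃ k ∈ K, ∃ k' ∈ K, G.edist i k + G.edist k' j ≤ p.length := by
  induction p with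
  | nil => exact Or.inl ⟨⟨SimpleGraph.Walk.nil, rfl⟩, by simp⟩
  | @cons i a j hadj p ih =>
    have hlen : ((SimpleGraph.Walk.cons hadj p).length : ℕ∞) = 1 + (p.length : ℕ∞) := by
      rw [SimpleGraph.Walk.length_cons]; push_cast; exact add_comm _ _
    have hle : (p.length : ℕ∞) ≤ 1 + (p.length : ℕ∞) := le_add_self
    rw [hlen]
    rcases h i a hadj with ⟨hQ, hG⟩ | ⟨hi, ha⟩
    · have h1 : ∀ x, G.edist i x ≤ 1 + G.edist a x := fun x => by
        rw [← SimpleGraph.edist_eq_one_iff_adj.2 hG]; exact G.edist_triangle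
      rcases ih with ⟨⟨q, hq⟩, hd⟩ | ⟨k, hk, k', hk', hd⟩
      · exact Or.inl ⟨⟨SimpleGraph.Walk.cons hQ q, by simp [hq]⟩,
          (h1 j).trans (add_le_add le_rfl hd)⟩
      · refine Or.inr ⟨k, hk, k', hk', (add_le_add (h1 k) le_rfl).trans ?_⟩
        rw [add_assoc]
        exact add_le_add le_rfl hd
    · rcases ih with ⟨-, hd⟩ | ⟨k, hk, k', hk', hd⟩
      · exact Or.inr ⟨i, hi, a, ha, by rw [G.edist_self, zero_add]; exact hd.trans hle⟩
      · exact Or.inr ⟨i, hi, k', hk', by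
          rw [G.edist_self, zero_add]; exact (le_add_self.trans hd).trans hle⟩

/-- If a geodesic of `P` transfers to `Q`, then the distance in `Q` is strictly smaller than `l`, so
a geodesic of `Q` cannot transfer back and must use an altered edge. -/
theorem exists_edist_add_le_of_edist_eq {V : Type*} {G P Q : SimpleGraph V} {K : Set V}
    (hPQ : ∀ a b, P.Adj a b → (Q.Adj a b ∧ G.Adj a b) ∨ (a ∈ K ∧ b ∈ K))
    (hQP : ∀ a b, Q.Adj a b → (P.Adj a b ∧ G.Adj a b) ∨ (a ∈ K ∧ b ∈ K)) {i j : V} {l : ℕ}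
    (hP : P.edist i j = l) (hQ : Q.edist i j ≠ l) :
    ∃ k ∈ K, ∃ k' ∈ K, G.edist i k + G.edist k' j ≤ l := by
  obtain ⟨p, hp⟩ := exists_walk_length_of_edist_eq hP
  rcases walk_transfer_or_exists hPQ p with ⟨⟨q, hq⟩, -⟩ | h
  · have hlt : Q.edist i j < l := by
      refine lt_of_le_of_ne ?_ hQ
      rw [← hp, ← hq]; exact SimpleGraph.edist_le q
    obtain ⟨m, hm⟩ := ENat.ne_top_iff_exists.1 hlt.ne_top
    obtain ⟨q', hq'⟩ := exists_walk_length_of_edist_eq hm.symm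
    rw [← hm] at hlt
    rcases walk_transfer_or_exists hQP q' with ⟨⟨p', hp'⟩, -⟩ | ⟨k, hk, k', hk', h⟩
    · have h1 := SimpleGraph.edist_le p'
      rw [hP, hp', hq'] at h1
      exact absurd hlt (not_lt.2 h1)
    · rw [hq'] at h
      exact ⟨k, hk, k', hk', h.trans hlt.le⟩
  · rw [hp] at h
    exact h

/-- The distance from a vertex to a set of vertices. -/
noncomputable def setEdist {V : Type*} (G : SimpleGraph V) (K : Set V) (i : V) : ℕ∞ :=
  sInf ((fun k => G.edist i k) '' K)

theorem setEdist_add_le_of_distanceMatrix_ne {n : ℕ} {G H : SimpleGraph (Fin n)} {l : ℕ}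
    {i j : Fin n} (h : (distanceMatrix H l - distanceMatrix G l) i j ≠ 0) :
    setEdist G (affectedVertices G H) i + setEdist G (affectedVertices G H) j ≤ l := by
  set K := affectedVertices G H with hK
  have hmem : ∀ a b, ¬ (G.Adj a b ↔ H.Adj a b) → a ∈ K ∧ b ∈ K := fun a b hab =>
    ⟨⟨b, hab⟩, ⟨a, by rwa [G.adj_comm, H.adj_comm]⟩⟩
  have hGH : ∀ a b, G.Adj a b → (H.Adj a b ∧ G.Adj a b) ∨ (a ∈ K ∧ b ∈ K) := fun a b hab => by
    by_cases hb : H.Adj a b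
    · exact Or.inl ⟨hb, hab⟩
    · exact Or.inr (hmem a b (by tauto))
  have hHG : ∀ a b, H.Adj a b → (G.Adj a b ∧ G.Adj a b) ∨ (a ∈ K ∧ b ∈ K) := fun a b hab => by
    by_cases hb : G.Adj a b
    · exact Or.inl ⟨hb, hb⟩
    · exact Or.inr (hmem a b (by tauto))
  have hex : ∃ k ∈ K, ∃ k' ∈ K, G.edist i k + G.edist k' j ≤ l := by
    simp only [distanceMatrix, Matrix.sub_apply, Matrix.of_apply] at h
    by_cases h1 : G.edist i j = l
    · by_cases h2 : H.edist i j = l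
      · simp [h1, h2] at h
      · exact exists_edist_add_le_of_edist_eq hGH hHG h1 h2
    · by_cases h2 : H.edist i j = l
      · exact exists_edist_add_le_of_edist_eq hHG hGH h2 h1
      · simp [h1, h2] at h
  obtain ⟨k, hk, k', hk', hle⟩ := hex
  refine le_trans (add_le_add (sInf_le ⟨k, hk, rfl⟩) (sInf_le ⟨k', hk', ?_⟩)) hle
  exact G.edist_comm

open Classical in
theorem card_setEdist_eq_le {n : ℕ} (G : SimpleGraph (Fin n)) (K : Set (Fin n)) {t : ℕ} {b : ℝ}
    (hb : ∀ v, ((sphere G v t).card : ℝ) ≤ b) :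
    ((Finset.univ.filter fun j => setEdist G K j = t).card : ℝ) ≤ K.ncard * b := by
  have hsub : (Finset.univ.filter fun j => setEdist G K j = t)
      ⊆ K.toFinset.biUnion fun k => sphere G k t := by
    intro j hj
    have hj' : setEdist G K j = t := (Finset.mem_filter.1 hj).2
    -- The infimum of the empty set is `⊤`; a nonempty set in `ℕ∞` attains its infimum.
    have hne : ((fun k => G.edist j k) '' K).Nonempty := by
      by_contra hemp
      rw [Set.not_nonempty_iff_eq_empty] at hemp
      rw [setEdist, hemp, sInf_empty] at hj'
      exact ENat.natCast_ne_top t hj'.symm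
    obtain ⟨k, hk, hkj⟩ := csInf_mem hne
    refine Finset.mem_biUnion.2 ⟨k, Set.mem_toFinset.2 hk, mem_sphere.2 ?_⟩
    rw [G.edist_comm, ← hj']
    exact hkj
  calc ((Finset.univ.filter fun j => setEdist G K j = t).card : ℝ)
      ≤ ((K.toFinset.biUnion fun k => sphere G k t).card : ℝ) := by
        exact_mod_cast Finset.card_le_card hsub
    _ ≤ ∑ k ∈ K.toFinset, ((sphere G k t).card : ℝ) := by exact_mod_cast Finset.card_biUnion_le
    _ ≤ ∑ k ∈ K.toFinset, b := Finset.sum_le_sum fun k _ => hb k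
    _ = K.ncard * b := by
        rw [Finset.sum_const, nsmul_eq_mul, Set.ncard_eq_toFinset_card']

/-! ### Spectral radius bounds from weighted row sums. -/

/-- A weighted row sum bound for the spectral radius. -/
theorem matrixSpectralRadius_le_of_sum_le {n : ℕ} {A : Matrix (Fin n) (Fin n) ℝ} {u : Fin n → ℝ}
    (hu : ∀ i, 0 < u i) {R : ℝ} (h : ∀ i, ∑ j, |A i j| * u j ≤ R * u i) :
    matrixSpectralRadius A ≤ ENNReal.ofReal R := by
  refine iSup₂_le fun z hz => ?_
  rw [spectrum.mem_iff, Matrix.isUnit_iff_isUnit_det, isUnit_iff_ne_zero, not_not] at hz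
  obtain ⟨x, hx0, hx⟩ := Matrix.exists_mulVec_eq_zero_iff.2 hz
  have hx' : ∀ i, z * x i = ∑ j, (A i j : ℂ) * x j := by
    intro i
    have := congrFun hx i
    rw [Matrix.sub_mulVec, Pi.sub_apply, Pi.zero_apply, sub_eq_zero, Algebra.algebraMap_eq_smul_one,
      Matrix.smul_mulVec, Matrix.one_mulVec] at this
    simpa [Matrix.mulVec, dotProduct] using this
  obtain ⟨i₀, hi₀⟩ := Function.ne_iff.1 hx0
  have : Nonempty (Fin n) := ⟨i₀⟩
  -- The eigenvalue equation is read at the coordinate where the eigenvector is largest relative to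
  -- the weights.
  obtain ⟨i, hi⟩ := Finite.exists_max fun i => ‖x i‖ / u i
  have hxi : 0 < ‖x i‖ / u i :=
    lt_of_lt_of_le (div_pos (norm_pos_iff.2 hi₀) (hu i₀)) (hi i₀)
  set m := ‖x i‖ / u i with hm
  have hmx : ‖x i‖ = m * u i := by rw [hm, div_mul_cancel₀ _ (hu i).ne']
  have hle : ‖z‖ * (m * u i) ≤ R * (m * u i) := by
    calc ‖z‖ * (m * u i) = ‖∑ j, (A i j : ℂ) * x j‖ := by rw [← hmx, ← norm_mul, hx']
      _ ≤ ∑ j, ‖(A i j : ℂ) * x j‖ := norm_sum_le _ _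
      _ ≤ ∑ j, m * (|A i j| * u j) := by
          refine Finset.sum_le_sum fun j _ => ?_
          rw [norm_mul, Complex.norm_real, Real.norm_eq_abs]
          have := (div_le_iff₀ (hu j)).1 (hi j)
          calc |A i j| * ‖x j‖ ≤ |A i j| * (m * u j) :=
                mul_le_mul_of_nonneg_left this (abs_nonneg _)
            _ = _ := by ring
      _ = m * ∑ j, |A i j| * u j := by rw [Finset.mul_sum]
      _ ≤ m * (R * u i) := mul_le_mul_of_nonneg_left (h i) hxi.le
      _ = R * (m * u i) := by ring
  have hz : ‖z‖ ≤ R := le_of_mul_le_mul_right hle (mul_pos hxi (hu i))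
  rw [← enorm_eq_nnnorm, ← ofReal_norm]
  exact ENNReal.ofReal_le_ofReal hz

/-- With weights `q ^ (-d)`, a row at `d i = s` sums to about `∑ t ≤ l - s, C * q ^ t`, which is of
order `C * q ^ l` times its own weight `q ^ (-s)`. Growth at rate `q * q` thus costs only `q ^ l`.
-/
theorem matrixSpectralRadius_le_of_growth {n : ℕ} {A : Matrix (Fin n) (Fin n) ℝ}
    {d : Fin n → ℕ∞} {l : ℕ} {C q : ℝ} (hq : 1 < q) (hC : 0 ≤ C) (hA1 : ∀ i j, |A i j| ≤ 1)
    (hA : ∀ i j, A i j ≠ 0 → d i + d j ≤ l)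
    (hd : ∀ t ≤ l, (Set.ncard {j | d j = (t : ℕ∞)} : ℝ) ≤ C * (q * q) ^ t) :
    matrixSpectralRadius A ≤ ENNReal.ofReal (C * (q / (q - 1)) * q ^ l) := by
  classical
  have hq0 : 0 < q := by linarith
  have hq1 : 0 < q - 1 := by linarith
  -- Where `d i = ⊤` the weight is `1`; the row and the column of `i` then vanish.
  refine matrixSpectralRadius_le_of_sum_le (u := fun i => (q ^ (d i).toNat)⁻¹)
    (fun i => by positivity) fun i => ?_
  by_cases hrow : ∀ j, A i j = 0
  · simp only [hrow, abs_zero, zero_mul, Finset.sum_const_zero]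
    positivity
  obtain ⟨j₀, hj₀⟩ := not_forall.1 hrow
  have hdi : d i ≤ l := le_self_add.trans (hA i j₀ hj₀)
  obtain ⟨s, hs⟩ := ENat.ne_top_iff_exists.1 (ne_top_of_le_ne_top (ENat.natCast_ne_top l) hdi)
  have hsl : s ≤ l := by rw [← hs] at hdi; exact_mod_cast hdi
  have hterm : ∀ j, |A i j| * (q ^ (d j).toNat)⁻¹
      ≤ ∑ t ∈ Finset.range (l - s + 1), if d j = (t : ℕ∞) then (q ^ t)⁻¹ else 0 := by
    intro j
    by_cases hj : A i j = 0
    · rw [hj, abs_zero, zero_mul]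
      refine Finset.sum_nonneg fun t _ => ?_
      split_ifs
      · positivity
      · exact le_rfl
    · have hle := hA i j hj
      obtain ⟨t, ht⟩ := ENat.ne_top_iff_exists.1
        (ne_top_of_le_ne_top (ENat.natCast_ne_top l) (le_add_self.trans hle))
      rw [← hs, ← ht] at hle
      have hst : s + t ≤ l := by exact_mod_cast hle
      have hnn : ∀ t' ∈ Finset.range (l - s + 1),
          0 ≤ if d j = (t' : ℕ∞) then (q ^ t')⁻¹ else 0 := fun t' _ => by
        split_ifs
        · positivity
        · exact le_rfl
      refine le_trans ?_ (Finset.single_le_sum hnn (Finset.mem_range.2 (by omega : t < l - s + 1)))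
      rw [if_pos ht.symm, ← ht, ENat.toNat_natCast]
      exact mul_le_of_le_one_left (by positivity) (hA1 i j)
  calc ∑ j, |A i j| * (q ^ (d j).toNat)⁻¹
      ≤ ∑ j, ∑ t ∈ Finset.range (l - s + 1), (if d j = (t : ℕ∞) then (q ^ t)⁻¹ else 0) :=
        Finset.sum_le_sum fun j _ => hterm j
    _ = ∑ t ∈ Finset.range (l - s + 1), (Set.ncard {j | d j = (t : ℕ∞)} : ℝ) * (q ^ t)⁻¹ := by
        rw [Finset.sum_comm]
        refine Finset.sum_congr rfl fun t _ => ?_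
        rw [← Finset.sum_filter, Finset.sum_const, nsmul_eq_mul, Set.ncard_eq_toFinset_card']
        congr 3
        ext j
        simp
    _ ≤ ∑ t ∈ Finset.range (l - s + 1), C * q ^ t := by
        refine Finset.sum_le_sum fun t ht => ?_
        have htl : t ≤ l := by have := Finset.mem_range.1 ht; omega
        calc (Set.ncard {j | d j = (t : ℕ∞)} : ℝ) * (q ^ t)⁻¹
            ≤ C * (q * q) ^ t * (q ^ t)⁻¹ :=
              mul_le_mul_of_nonneg_right (hd t htl) (by positivity)
          _ = C * q ^ t := by rw [mul_pow]; field_simp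
    _ = C * ((q ^ (l - s + 1) - 1) / (q - 1)) := by
        rw [← Finset.mul_sum, geom_sum_eq hq.ne']
    _ ≤ C * (q ^ (l - s + 1) / (q - 1)) := by gcongr; linarith
    _ = C * (q / (q - 1)) * q ^ l * (q ^ (d i).toNat)⁻¹ := by
        rw [← hs, ENat.toNat_natCast]
        have : q ^ l = q ^ (l - s) * q ^ s := by rw [← pow_add]; congr 1; omega
        rw [this, pow_succ]
        field_simp

theorem matrixSpectralRadius_distanceMatrix_sub_le {n : ℕ} {G H : SimpleGraph (Fin n)} {l : ℕ}
    {L m : ℝ} (hm : 1 < m) (hL : 0 ≤ L) (hG : ∀ v, ∀ t ≤ l, ((sphere G v t).card : ℝ) ≤ L * m ^ t)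
    {g : ℕ} (hg : (affectedVertices G H).ncard ≤ g) :
    matrixSpectralRadius (distanceMatrix H l - distanceMatrix G l)
      ≤ ENNReal.ofReal (g * L * (√m / (√m - 1)) * √m ^ l) := by
  classical
  have hsq : √m * √m = m := Real.mul_self_sqrt (by linarith)
  refine matrixSpectralRadius_le_of_growth (d := setEdist G (affectedVertices G H))
    (Real.lt_sqrt_of_sq_lt (by linarith)) (by positivity) ?_
    (fun i j => setEdist_add_le_of_distanceMatrix_ne) fun t ht => ?_
  · intro i j
    simp only [distanceMatrix, Matrix.sub_apply, Matrix.of_apply]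
    split_ifs <;> norm_num
  · rw [hsq]
    have h := card_setEdist_eq_le G (affectedVertices G H) fun v => hG v t ht
    rw [Set.ncard_eq_toFinset_card']
    have hg' : ((affectedVertices G H).ncard : ℝ) ≤ g := by exact_mod_cast hg
    calc _ ≤ ((affectedVertices G H).ncard : ℝ) * (L * m ^ t) := by
          refine le_trans (le_of_eq ?_) h
          congr 2
          ext j
          simp
      _ ≤ g * (L * m ^ t) := by gcongr
      _ = _ := by ring

end Perturbation

/-! ### Concentration of the types and uniform bounds on the spheres. -/

section HighProbability

variable {r : ℕ}

theorem sum_types_exp (B : BlockModel r) (n : ℕ) (g : Fin r → ℝ) :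
    ∑ s : Fin n → Fin r, (∏ v, B.prior (s v)) * Real.exp (∑ v, g (s v))
      = (∑ i, B.prior i * Real.exp (g i)) ^ n := by
  rw [Fintype.sum_pow]
  refine Finset.sum_congr rfl fun s _ => ?_
  rw [Real.exp_sum, Finset.prod_mul_distrib]

/-- Second order bound `exp y ≤ 1 + y + y ^ 2` for `|y| ≤ 1`; the linear term averages to zero. -/
theorem sum_prior_mul_exp_le (B : BlockModel r) {g : Fin r → ℝ} (hg : ∑ i, B.prior i * g i = 0)
    {C t : ℝ} (hC : ∀ i, |g i| ≤ C) (ht : 0 ≤ t) (htC : t * C ≤ 1) :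
    ∑ i, B.prior i * Real.exp (t * g i) ≤ Real.exp (t ^ 2 * C ^ 2) := by
  have h1 : ∀ i, Real.exp (t * g i) ≤ 1 + t * g i + t ^ 2 * C ^ 2 := by
    intro i
    have habs : |t * g i| ≤ t * C := by
      rw [abs_mul, abs_of_nonneg ht]
      exact mul_le_mul_of_nonneg_left (hC i) ht
    have h := (abs_le.1 (Real.abs_exp_sub_one_sub_id_le (habs.trans htC))).2
    have h2 : (t * g i) ^ 2 ≤ (t * C) ^ 2 := sq_le_sq' (abs_le.1 habs).1 (abs_le.1 habs).2
    linarith [mul_pow t C 2]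
  calc ∑ i, B.prior i * Real.exp (t * g i)
      ≤ ∑ i, B.prior i * (1 + t * g i + t ^ 2 * C ^ 2) :=
        Finset.sum_le_sum fun i _ => mul_le_mul_of_nonneg_left (h1 i) (B.prior_nonneg i)
    _ = (∑ i, B.prior i) * (1 + t ^ 2 * C ^ 2) + t * ∑ i, B.prior i * g i := by
        rw [Finset.sum_mul, Finset.mul_sum, ← Finset.sum_add_distrib]
        exact Finset.sum_congr rfl fun i _ => by ring
    _ = t ^ 2 * C ^ 2 + 1 := by rw [B.prior_sum, hg]; ring
    _ ≤ _ := Real.add_one_le_exp _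

/-- The types for which every vertex has expected degree at most `b`. -/
def TypesBalanced (B : BlockModel r) {n : ℕ} (b : ℝ) (s : Fin n → Fin r) : Prop :=
  ∀ j, ∑ u, B.edgeProb n (s u) j ≤ b

open Classical in
theorem sum_types_not_balanced_le (B : BlockModel r) {n : ℕ} (hn : 0 < n) {α : ℝ}
    (hα : ∀ j, ∑ i, B.meanProgeny i j = α) {C ε : ℝ} (hC1 : 1 ≤ C)
    (hC : ∀ i j, |B.W i j - α| ≤ C) (hε : 0 ≤ ε) (hε1 : ε ≤ 1) :
    ∑ s : Fin n → Fin r, (∏ v, B.prior (s v)) * (if TypesBalanced B (α + ε) s then 0 else 1)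
      ≤ r * Real.exp (-(n * ε ^ 2 / (4 * C ^ 2))) := by
  have hC0 : 0 < C := by linarith
  have hn' : (0 : ℝ) < n := by exact_mod_cast hn
  -- The minimiser of the Chernoff exponent `t ^ 2 * C ^ 2 - t * ε`.
  set t := ε / (2 * C ^ 2) with ht
  have ht0 : 0 ≤ t := by positivity
  have htC : t * C ≤ 1 := by
    rw [ht, div_mul_eq_mul_div, div_le_one (by positivity)]
    nlinarith
  have hmean : ∀ j, ∑ i, B.prior i * (B.W i j - α) = 0 := by
    intro j
    have h := hα j
    simp only [BlockModel.meanProgeny, Matrix.diagonal_mul] at h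
    simp only [mul_sub, Finset.sum_sub_distrib, ← Finset.sum_mul, h, B.prior_sum]
    ring
  have hind : ∀ s : Fin n → Fin r, (if TypesBalanced B (α + ε) s then (0 : ℝ) else 1)
      ≤ ∑ j, Real.exp (∑ v, t * (B.W (s v) j - α)) * Real.exp (-(t * (n * ε))) := by
    intro s
    split_ifs with hs
    · exact Finset.sum_nonneg fun j _ => by positivity
    · obtain ⟨j, hj⟩ := not_forall.1 hs
      rw [not_le] at hj
      refine le_trans ?_ (Finset.single_le_sum (fun j _ => by positivity) (Finset.mem_univ j))
      rw [← Real.exp_add]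
      refine Real.one_le_exp ?_
      have h1 : ∑ u, B.edgeProb n (s u) j ≤ (∑ u, B.W (s u) j) / n := by
        rw [Finset.sum_div]
        exact Finset.sum_le_sum fun u _ => min_le_left _ _
      have h2 : (α + ε) * n ≤ ∑ u, B.W (s u) j := (le_div_iff₀ hn').1 (hj.le.trans h1)
      have h3 : ∑ v, t * (B.W (s v) j - α) = t * (∑ v, B.W (s v) j - n * α) := by
        rw [← Finset.mul_sum, Finset.sum_sub_distrib]
        simp
      rw [h3]
      nlinarith
  have hprior : ∀ s : Fin n → Fin r, 0 ≤ ∏ v, B.prior (s v) := fun s =>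
    Finset.prod_nonneg fun v _ => B.prior_nonneg _
  calc ∑ s : Fin n → Fin r, (∏ v, B.prior (s v)) * (if TypesBalanced B (α + ε) s then 0 else 1)
      ≤ ∑ s : Fin n → Fin r, (∏ v, B.prior (s v))
          * ∑ j, Real.exp (∑ v, t * (B.W (s v) j - α)) * Real.exp (-(t * (n * ε))) :=
        Finset.sum_le_sum fun s _ => mul_le_mul_of_nonneg_left (hind s) (hprior s)
    _ = ∑ j, (∑ i, B.prior i * Real.exp (t * (B.W i j - α))) ^ n
          * Real.exp (-(t * (n * ε))) := by
        simp only [Finset.mul_sum]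
        rw [Finset.sum_comm]
        refine Finset.sum_congr rfl fun j _ => ?_
        rw [← sum_types_exp B n fun i => t * (B.W i j - α), Finset.sum_mul]
        exact Finset.sum_congr rfl fun s _ => by ring
    _ ≤ ∑ _j : Fin r, Real.exp (t ^ 2 * C ^ 2) ^ n * Real.exp (-(t * (n * ε))) := by
        refine Finset.sum_le_sum fun j _ => ?_
        have h0 : 0 ≤ ∑ i, B.prior i * Real.exp (t * (B.W i j - α)) :=
          Finset.sum_nonneg fun i _ => mul_nonneg (B.prior_nonneg i) (Real.exp_pos _).le
        have h1 := sum_prior_mul_exp_le B (hmean j) (fun i => hC i j) ht0 htC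
        gcongr
    _ = r * Real.exp (-(n * ε ^ 2 / (4 * C ^ 2))) := by
        rw [Finset.sum_const, Finset.card_univ, Fintype.card_fin, nsmul_eq_mul,
          ← Real.exp_nat_mul, ← Real.exp_add]
        congr 2
        rw [ht]
        field_simp
        ring

/-- All spheres of radius at most `l` have at most the size expected up to a factor `L`. -/
def SpheresBounded {n : ℕ} (L b : ℝ) (l : ℕ) (G : SimpleGraph (Fin n)) : Prop :=
  ∀ v, ∀ t ≤ l, ((sphere G v t).card : ℝ) ≤ L * b ^ t

open Classical in
theorem graphMean_not_spheresBounded_le (B : BlockModel r) {n : ℕ} {s : Fin n → Fin r} {b : ℝ}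
    (hs : TypesBalanced B b s) {k c : ℝ} (hk : 0 ≤ k) (hb : 4 ≤ k * (b - 1)) (hb1 : 1 ≤ b)
    (hc : 0 ≤ c) (hkc : k * c ≤ 1) (hc' : c ≤ 1 / 2) (L : ℝ) (l : ℕ) :
    graphMean B s (fun G => if SpheresBounded L b l G then 0 else 1)
      ≤ n * (l + 1) * Real.exp (2 * c - c * L) := by
  have hb0 : 0 < b := by linarith
  -- After `t` generations `x t` grows to `c`, so the moment is at most `exp (c + k * c ^ 2) ≤ exp
  -- (2 * c)` at every radius; Markov and a union bound over centres and radii follow.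
  let x : ℕ → ℝ := fun t => c / b ^ t
  have hx : ∀ t, x t * b ^ t = c := fun t => div_mul_cancel₀ _ (by positivity)
  have hx0 : ∀ t, 0 ≤ x t := fun t => by positivity
  have hone : ∀ v t, graphMean B s (fun G => Real.exp ((x t + k * x t ^ 2)
      * (bfsLayer G t {v} (Finset.univ \ {v})).card)) ≤ Real.exp (2 * c) := by
    intro v t
    refine (graphMean_exp_card_bfsLayer_le B s hs hk hb hb1 (hx0 t) t (by rwa [hx]) (by rwa [hx])
      Finset.disjoint_sdiff).trans ?_
    rw [hx, Finset.card_singleton, Nat.cast_one, mul_one]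
    refine Real.exp_le_exp.2 ?_
    nlinarith
  have hind : ∀ G : SimpleGraph (Fin n), (if SpheresBounded L b l G then (0 : ℝ) else 1)
      ≤ ∑ v, ∑ t ∈ Finset.range (l + 1), Real.exp ((x t + k * x t ^ 2)
        * (bfsLayer G t {v} (Finset.univ \ {v})).card) * Real.exp (-(c * L)) := by
    intro G
    split_ifs with hG
    · exact Finset.sum_nonneg fun v _ => Finset.sum_nonneg fun t _ => by positivity
    · simp only [SpheresBounded, not_forall, not_le] at hG
      obtain ⟨v, t, ht, hlt⟩ := hG
      refine le_trans ?_ (Finset.single_le_sum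
        (fun v _ => Finset.sum_nonneg fun t _ => by positivity) (Finset.mem_univ v))
      refine le_trans ?_ (Finset.single_le_sum (fun t _ => by positivity)
        (Finset.mem_range.2 (Nat.lt_succ_of_le ht)))
      rw [← Real.exp_add, ← sphere_eq_bfsLayer]
      refine Real.one_le_exp ?_
      have h1 : c * L ≤ x t * (sphere G v t).card := by
        calc c * L = x t * (L * b ^ t) := by rw [← hx t]; ring
          _ ≤ _ := mul_le_mul_of_nonneg_left hlt.le (hx0 t)
      have h2 : 0 ≤ k * x t ^ 2 * (sphere G v t).card := by positivity
      linarith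
  calc graphMean B s (fun G => if SpheresBounded L b l G then 0 else 1)
      ≤ graphMean B s (fun G => ∑ v, ∑ t ∈ Finset.range (l + 1), Real.exp ((x t + k * x t ^ 2)
        * (bfsLayer G t {v} (Finset.univ \ {v})).card) * Real.exp (-(c * L))) :=
        graphMean_mono B s hind
    _ = ∑ v, ∑ t ∈ Finset.range (l + 1), graphMean B s (fun G => Real.exp ((x t + k * x t ^ 2)
        * (bfsLayer G t {v} (Finset.univ \ {v})).card)) * Real.exp (-(c * L)) := by
        rw [graphMean_sum]
        refine Finset.sum_congr rfl fun v _ => ?_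
        rw [graphMean_sum]
        exact Finset.sum_congr rfl fun t _ => graphMean_mul_const _ _ _ _
    _ ≤ ∑ _v : Fin n, ∑ _t ∈ Finset.range (l + 1), Real.exp (2 * c) * Real.exp (-(c * L)) :=
        Finset.sum_le_sum fun v _ => Finset.sum_le_sum fun t _ =>
          mul_le_mul_of_nonneg_right (hone v t) (Real.exp_pos _).le
    _ = n * (l + 1) * Real.exp (2 * c - c * L) := by
        rw [Finset.sum_const, Finset.sum_const, Finset.card_univ, Fintype.card_fin,
          Finset.card_range, nsmul_eq_mul, nsmul_eq_mul, ← Real.exp_add, sub_eq_add_neg]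
        push_cast
        ring

open Classical in
theorem sum_weight_not_spheresBounded_le (B : BlockModel r) {n : ℕ} {b L : ℝ} {l : ℕ}
    {δ₁ δ₂ : ℝ} (hδ₂ : 0 ≤ δ₂)
    (h1 : ∑ s : Fin n → Fin r, (∏ v, B.prior (s v)) * (if TypesBalanced B b s then 0 else 1) ≤ δ₁)
    (h2 : ∀ s : Fin n → Fin r, TypesBalanced B b s →
      graphMean B s (fun G => if SpheresBounded L b l G then 0 else 1) ≤ δ₂) :
    ∑ x : (Fin n → Fin r) × SimpleGraph (Fin n),
      B.weight x * (if SpheresBounded L b l x.2 then 0 else 1) ≤ δ₁ + δ₂ := by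
  have hprior : ∀ s : Fin n → Fin r, 0 ≤ ∏ v, B.prior (s v) := fun s =>
    Finset.prod_nonneg fun v _ => B.prior_nonneg _
  have hsum : ∑ s : Fin n → Fin r, ∏ v, B.prior (s v) = 1 := by
    rw [← Fintype.sum_pow, B.prior_sum, one_pow]
  have hs : ∀ s : Fin n → Fin r,
      graphMean B s (fun G => if SpheresBounded L b l G then 0 else 1)
        ≤ (if TypesBalanced B b s then 0 else 1) + δ₂ := by
    intro s
    split_ifs with h
    · rw [zero_add]; exact h2 s h
    · have : graphMean B s (fun G => if SpheresBounded L b l G then 0 else 1)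
          ≤ graphMean B s (fun _ => 1) :=
        graphMean_mono B s fun G => by split_ifs <;> norm_num
      have h' : graphMean B s (fun _ => 1) = 1 := by
        simp only [graphMean, mul_one, B.graphWeight_sum]
      linarith
  calc ∑ x : (Fin n → Fin r) × SimpleGraph (Fin n),
      B.weight x * (if SpheresBounded L b l x.2 then 0 else 1)
      = ∑ s : Fin n → Fin r, (∏ v, B.prior (s v))
          * graphMean B s (fun G => if SpheresBounded L b l G then 0 else 1) := by
        rw [Fintype.sum_prod_type]
        refine Finset.sum_congr rfl fun s _ => ?_
        rw [graphMean, Finset.mul_sum]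
        exact Finset.sum_congr rfl fun G _ => by rw [BlockModel.weight, mul_assoc]
    _ ≤ ∑ s : Fin n → Fin r, (∏ v, B.prior (s v))
          * ((if TypesBalanced B b s then 0 else 1) + δ₂) :=
        Finset.sum_le_sum fun s _ => mul_le_mul_of_nonneg_left (hs s) (hprior s)
    _ ≤ δ₁ + δ₂ := by
        simp only [mul_add, Finset.sum_add_distrib, ← Finset.sum_mul, hsum, one_mul]
        linarith

open Classical in
theorem ofReal_one_sub_le_law (B : BlockModel r) {n : ℕ}
    {S : Set ((Fin n → Fin r) × SimpleGraph (Fin n))} {δ : ℝ}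
    (h : ∑ x : (Fin n → Fin r) × SimpleGraph (Fin n), B.weight x * (if x ∈ S then 0 else 1) ≤ δ) :
    ENNReal.ofReal (1 - δ) ≤ (B.law n).toOuterMeasure S := by
  have h1 : (B.law n).toOuterMeasure S
      = ENNReal.ofReal (∑ x, B.weight x * (if x ∈ S then 1 else 0)) := by
    rw [PMF.toOuterMeasure_apply_fintype, ENNReal.ofReal_sum_of_nonneg]
    · refine Finset.sum_congr rfl fun x _ => ?_
      by_cases hx : x ∈ S
      · simp [hx, BlockModel.law]
      · simp [hx]
    · intro x _
      have := B.weight_nonneg x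
      positivity
  rw [h1]
  refine ENNReal.ofReal_le_ofReal ?_
  have h2 : ∑ x : (Fin n → Fin r) × SimpleGraph (Fin n), B.weight x * (if x ∈ S then 0 else 1)
      + ∑ x, B.weight x * (if x ∈ S then 1 else 0) = 1 := by
    rw [← Finset.sum_add_distrib]
    refine Eq.trans ?_ (B.weight_sum n)
    refine Finset.sum_congr rfl fun x _ => ?_
    split_ifs <;> ring
  linarith

theorem law_toOuterMeasure_le_one (B : BlockModel r) {n : ℕ}
    (S : Set ((Fin n → Fin r) × SimpleGraph (Fin n))) : (B.law n).toOuterMeasure S ≤ 1 :=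
  ((B.law n).toOuterMeasure.mono (Set.subset_univ S)).trans
    ((PMF.toOuterMeasure_apply_eq_one_iff _ _).2 (Set.subset_univ _)).le

/-- With high probability all spheres of logarithmic radius have the expected size, up to a
logarithmic factor. -/
theorem tendsto_law_spheresBounded (B : BlockModel r) {α m : ℝ}
    (hα : ∀ j, ∑ i, B.meanProgeny i j = α) (hαm : α ≤ m) (hm : 1 < m) {l : ℕ → ℕ}
    (hl : (fun n => (l n : ℝ)) =O[atTop] fun n : ℕ => Real.log n) :
    ∃ c : ℝ, 0 ≤ c ∧ Tendsto (fun n : ℕ => (B.law n).toOuterMeasure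
      {x | SpheresBounded (c * Real.log n) m (l n) x.2}) atTop (𝓝 1) := by
  classical
  set k : ℝ := 4 / (m - 1) with hk
  have hm0 : 0 < m - 1 := by linarith
  have hk0 : 0 < k := by positivity
  set c : ℝ := min (1 / k) (1 / 2) with hc
  have hc0 : 0 < c := by positivity
  have hkc : k * c ≤ 1 := by
    calc k * c ≤ k * (1 / k) := mul_le_mul_of_nonneg_left (min_le_left _ _) hk0.le
      _ = 1 := by field_simp
  obtain ⟨C, hC1, hC⟩ : ∃ C : ℝ, 1 ≤ C ∧ ∀ i j, |B.W i j - α| ≤ C := by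
    refine ⟨1 + ∑ i, ∑ j, |B.W i j - α|, ?_, fun i j => ?_⟩
    · have : 0 ≤ ∑ i, ∑ j, |B.W i j - α| :=
        Finset.sum_nonneg fun i _ => Finset.sum_nonneg fun j _ => abs_nonneg _
      linarith
    · have h1 : |B.W i j - α| ≤ ∑ j, |B.W i j - α| :=
        Finset.single_le_sum (f := fun j => |B.W i j - α|) (fun j _ => abs_nonneg _)
          (Finset.mem_univ j)
      have h2 : ∑ j, |B.W i j - α| ≤ ∑ i, ∑ j, |B.W i j - α| :=
        Finset.single_le_sum (f := fun i => ∑ j, |B.W i j - α|)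
          (fun i _ => Finset.sum_nonneg fun j _ => abs_nonneg _) (Finset.mem_univ i)
      linarith
  -- Large enough that `n * ε n ^ 2 = √n` diverges, which makes unbalanced types unlikely; small
  -- enough that `ε n * l n → 0`, so `(m + ε n) ^ t ≤ exp 1 * m ^ t` for `t ≤ l n` eventually.
  let ε : ℕ → ℝ := fun n => (n : ℝ) ^ (-(1 / 4) : ℝ)
  have hlogo : ∀ p : ℝ, 0 < p → (fun n : ℕ => Real.log n) =o[atTop] fun n : ℕ => (n : ℝ) ^ p :=
    fun p hp => (isLittleO_log_rpow_atTop hp).comp_tendsto tendsto_natCast_atTop_atTop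
  have hεl : Tendsto (fun n => ε n * l n) atTop (𝓝 0) := by
    have h := (hl.trans_isLittleO (hlogo (1 / 4) (by norm_num))).tendsto_div_nhds_zero
    refine h.congr fun n => ?_
    simp only [ε]
    rw [Real.rpow_neg (Nat.cast_nonneg n), div_eq_mul_inv, mul_comm]
  have hln : ∀ᶠ n : ℕ in atTop, (l n : ℝ) + 1 ≤ n := by
    have h := (hl.trans_isLittleO (hlogo 1 one_pos)).bound (half_pos one_pos)
    filter_upwards [h, eventually_ge_atTop 2] with n hn hn2
    rw [Real.rpow_one, Real.norm_natCast, Real.norm_natCast] at hn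
    have : (2 : ℝ) ≤ n := by exact_mod_cast hn2
    linarith
  let δ : ℕ → ℝ := fun n => r * Real.exp (-((n : ℝ) ^ (1 / 2 : ℝ) / (4 * C ^ 2)))
    + Real.exp (2 * c) * (n : ℝ)⁻¹
  have hδ : Tendsto δ atTop (𝓝 0) := by
    have h1 : Tendsto (fun n : ℕ => (n : ℝ) ^ (1 / 2 : ℝ) / (4 * C ^ 2)) atTop atTop :=
      ((tendsto_rpow_atTop (by norm_num)).comp tendsto_natCast_atTop_atTop).atTop_div_const
        (by positivity)
    have h2 := (Real.tendsto_exp_neg_atTop_nhds_zero.comp h1).const_mul (r : ℝ)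
    have h3 := (tendsto_inv_atTop_nhds_zero_nat (𝕜 := ℝ)).const_mul (Real.exp (2 * c))
    rw [mul_zero] at h2 h3
    rw [← add_zero (0 : ℝ)]
    exact h2.add h3
  refine ⟨Real.exp 1 * (3 / c), by positivity, ?_⟩
  refine tendsto_of_tendsto_of_tendsto_of_le_of_le' (g := fun n => ENNReal.ofReal (1 - δ n)) ?_
    tendsto_const_nhds ?_ (Eventually.of_forall fun n => law_toOuterMeasure_le_one B _)
  · have h := ENNReal.tendsto_ofReal (hδ.const_sub 1)
    simpa using h
  · filter_upwards [hln, hεl.eventually_le_const one_pos, eventually_ge_atTop 1]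
      with n hln hεl hn
    have hn0 : (0 : ℝ) < n := by exact_mod_cast hn
    have hn1 : (1 : ℝ) ≤ n := by exact_mod_cast hn
    have hε0 : 0 ≤ ε n := Real.rpow_nonneg hn0.le _
    have hε1 : ε n ≤ 1 := Real.rpow_le_one_of_one_le_of_nonpos hn1 (by norm_num)
    have hlog : 0 ≤ Real.log n := Real.log_nonneg hn1
    have hsq : (n : ℝ) * ε n ^ 2 = (n : ℝ) ^ (1 / 2 : ℝ) := by
      simp only [ε]
      rw [← Real.rpow_natCast, ← Real.rpow_mul hn0.le]
      nth_rewrite 1 [← Real.rpow_one (n : ℝ)]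
      rw [← Real.rpow_add hn0]
      norm_num
    set b := m + ε n with hb
    have hb1 : 1 ≤ b := by linarith
    have hkb : 4 ≤ k * (b - 1) := by
      have : k * (m - 1) = 4 := by rw [hk]; field_simp
      nlinarith
    have hT := sum_types_not_balanced_le B hn hα hC1 hC hε0 hε1
    rw [hsq] at hT
    have hT' : ∑ s : Fin n → Fin r, (∏ v, B.prior (s v))
        * (if TypesBalanced B b s then 0 else 1)
        ≤ r * Real.exp (-((n : ℝ) ^ (1 / 2 : ℝ) / (4 * C ^ 2))) := by
      refine le_trans (Finset.sum_le_sum fun s _ => mul_le_mul_of_nonneg_left ?_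
        (Finset.prod_nonneg fun v _ => B.prior_nonneg _)) hT
      by_cases hs : TypesBalanced B (α + ε n) s
      · have : TypesBalanced B b s := fun j => (hs j).trans (by linarith)
        rw [if_pos hs, if_pos this]
      · rw [if_neg hs]
        split_ifs <;> norm_num
    have hexp : (n : ℝ) * (l n + 1) * Real.exp (2 * c - c * (3 / c * Real.log n))
        ≤ Real.exp (2 * c) * (n : ℝ)⁻¹ := by
      have h1 : Real.exp (2 * c - c * (3 / c * Real.log n))
          = Real.exp (2 * c) * ((n : ℝ) ^ 3)⁻¹ := by
        rw [Real.exp_sub]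
        have : c * (3 / c * Real.log n) = (3 : ℕ) * Real.log n := by
          push_cast; field_simp
        rw [this, Real.exp_nat_mul, Real.exp_log hn0, div_eq_mul_inv]
      rw [h1]
      calc (n : ℝ) * (l n + 1) * (Real.exp (2 * c) * ((n : ℝ) ^ 3)⁻¹)
          ≤ (n : ℝ) * n * (Real.exp (2 * c) * ((n : ℝ) ^ 3)⁻¹) := by gcongr
        _ = _ := by field_simp
    have hS := sum_weight_not_spheresBounded_le B (L := 3 / c * Real.log n) (l := l n)
      (by positivity) hT' fun s hs => (graphMean_not_spheresBounded_le B hs hk0.le hkb hb1 hc0.le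
        hkc (min_le_right _ _) _ _).trans hexp
    have hsub : ({x | SpheresBounded (3 / c * Real.log n) b (l n) x.2} :
        Set ((Fin n → Fin r) × SimpleGraph (Fin n)))
        ⊆ {x | SpheresBounded (Real.exp 1 * (3 / c) * Real.log n) m (l n) x.2} := by
      intro x hx v t ht
      refine (hx v t ht).trans ?_
      have h1 : b ≤ m * Real.exp (ε n) := by
        have := Real.add_one_le_exp (ε n)
        nlinarith
      have h2 : b ^ t ≤ Real.exp 1 * m ^ t := by
        calc b ^ t ≤ (m * Real.exp (ε n)) ^ t := by gcongr
          _ = Real.exp (t * ε n) * m ^ t := by rw [mul_pow, Real.exp_nat_mul, mul_comm]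
          _ ≤ Real.exp 1 * m ^ t := by
              gcongr
              have : (t : ℝ) ≤ l n := by exact_mod_cast ht
              nlinarith
      calc 3 / c * Real.log n * b ^ t ≤ 3 / c * Real.log n * (Real.exp 1 * m ^ t) := by gcongr
        _ = _ := by ring
    refine (ofReal_one_sub_le_law B (S := {x | SpheresBounded (3 / c * Real.log n) b (l n) x.2})
      hS).trans ((B.law n).toOuterMeasure.mono hsub)

/-- A common column sum of a matrix is one of its eigenvalues. -/
theorem ListsEigenvalues.colSum_le {M : Matrix (Fin r) (Fin r) ℝ} {μ : Fin r → ℝ}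
    (h : ListsEigenvalues M μ) (hr : 0 < r) {α : ℝ} (hα : ∀ j, ∑ i, M i j = α) :
    α ≤ |μ ⟨0, hr⟩| := by
  have hdet : (Matrix.scalar (Fin r) α - M).det = 0 := by
    refine Matrix.exists_vecMul_eq_zero_iff.1 ⟨fun _ => 1, fun h0 => ?_, ?_⟩
    · exact one_ne_zero (congrFun h0 ⟨0, hr⟩)
    · ext j
      simp only [Matrix.vecMul, dotProduct, one_mul, Matrix.sub_apply, Finset.sum_sub_distrib, hα,
        Pi.zero_apply, Matrix.scalar_apply, Matrix.diagonal_apply]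
      simp
  have h1 : (M.charpoly).eval α = 0 := by rw [Matrix.eval_charpoly, hdet]
  rw [h.1, Polynomial.eval_prod, Finset.prod_eq_zero_iff] at h1
  obtain ⟨i, -, hi⟩ := h1
  simp only [Polynomial.eval_sub, Polynomial.eval_X, Polynomial.eval_C, sub_eq_zero] at hi
  rw [hi]
  exact (le_abs_self _).trans (h.2 ⟨0, hr⟩ i (Nat.zero_le _))

end HighProbability

/-! ### Conclusion. -/

theorem mainTheorem7
    {r : ℕ} (hr : 1 < r) (B : BlockModel r)
    (hprior : ∀ i, B.prior i = 1 / (r : ℝ))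
    (hreg : B.meanProgeny.IsPrimitive)
    (α : ℝ) (hα : ∀ j, ∑ i, B.meanProgeny i j = α)
    (μ : Fin r → ℝ) (hμ : ListsEigenvalues B.meanProgeny μ)
    (μ₁ μ₂ τ : ℝ) (hμ₁ : μ₁ = μ ⟨0, Nat.zero_lt_of_lt hr⟩) (hμ₂ : μ₂ = μ ⟨1, hr⟩)
    (hμ₁_gt : 1 < μ₁) (hτ : τ = μ₂ ^ 2 / μ₁) (hτ_gt : 1 < τ)
    (κ : ℝ) (hκ_pos : 0 < κ) (hκ : κ < 1 / 12)
    (l : ℕ → ℕ) (hl : (fun n => (l n : ℝ)) ~[atTop] (fun n => κ * Real.logb α n))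
    (γ : ℕ → ℕ)
    (hγ : (fun n => (γ n : ℝ)) =o[atTop]
      (fun n => τ ^ ((l n : ℝ) / 2) / Real.log n)) :
    ∃ f : ℕ → ℝ, f =o[atTop] (fun n => μ₂ ^ l n) ∧
      Tendsto (fun n => (B.law n).toOuterMeasure
          {x | ∀ G' : SimpleGraph (Fin n), (affectedVertices x.2 G').ncard ≤ γ n →
            matrixSpectralRadius (distanceMatrix G' (l n) - distanceMatrix x.2 (l n))
              ≤ ENNReal.ofReal (f n)})
        atTop (𝓝 1) := by
  have hμ₁0 : 0 < μ₁ := by linarith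
  have hτ0 : 0 < τ := by linarith
  have hαμ : α ≤ μ₁ := by
    have h := hμ.colSum_le (Nat.zero_lt_of_lt hr) hα
    rwa [← hμ₁, abs_of_pos hμ₁0] at h
  have hlO : (fun n => (l n : ℝ)) =O[atTop] fun n : ℕ => Real.log n := by
    refine hl.isBigO.trans ?_
    have : (fun n : ℕ => κ * Real.logb α n) = fun n : ℕ => κ / Real.log α * Real.log n := by
      funext n
      rw [Real.logb]
      ring
    rw [this]
    exact (isBigO_refl _ _).const_mul_left _
  obtain ⟨c, hc, htend⟩ := tendsto_law_spheresBounded B hα hαμ hμ₁_gt hlO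
  set D := √μ₁ / (√μ₁ - 1) with hD
  refine ⟨fun n => γ n * (c * Real.log n) * D * √μ₁ ^ l n, ?_, ?_⟩
  · have h1 := (hγ.mul_isBigO
      (isBigO_refl (fun n : ℕ => Real.log n * √μ₁ ^ l n) atTop)).const_mul_left (c * D)
    -- This identity turns `τ ^ (l n / 2) * √μ₁ ^ l n` into `|μ₂| ^ l n`; absolute values are needed
    -- since `μ₂` may be negative.
    have h2 : √τ * √μ₁ = |μ₂| := by
      rw [← Real.sqrt_mul hτ0.le, hτ, div_mul_cancel₀ _ hμ₁0.ne', Real.sqrt_sq_eq_abs]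
    have h3 : (fun n : ℕ => τ ^ ((l n : ℝ) / 2) / Real.log n * (Real.log n * √μ₁ ^ l n))
        =ᶠ[atTop] fun n => |μ₂ ^ l n| := by
      filter_upwards [eventually_ge_atTop 2] with n hn
      have hlog : Real.log n ≠ 0 := (Real.log_pos (by exact_mod_cast hn)).ne'
      have h4 : τ ^ ((l n : ℝ) / 2) = √τ ^ l n := by
        rw [Real.sqrt_eq_rpow, ← Real.rpow_natCast, ← Real.rpow_mul hτ0.le]
        congr 1
        ring
      rw [h4, abs_pow, ← h2, mul_pow]
      field_simp
    refine ((h1.congr' (EventuallyEq.refl _ _) h3).congr_left fun n => ?_).of_abs_right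
    ring
  · refine tendsto_of_tendsto_of_tendsto_of_le_of_le' htend tendsto_const_nhds ?_
      (Eventually.of_forall fun n => law_toOuterMeasure_le_one B _)
    filter_upwards [eventually_ge_atTop 1] with n hn
    -- The event concerns the unaltered graph only, and on it the bound is deterministic, hence
    -- valid for all choices of the adversary at once.
    refine (B.law n).toOuterMeasure.mono fun x hx G' hG' => ?_
    have hlog : 0 ≤ Real.log n := Real.log_nonneg (by exact_mod_cast hn)
    exact matrixSpectralRadius_distanceMatrix_sub_le hμ₁_gt (by positivity) hx hG'
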